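/- Let $F$ be a field of characteristic $\neq 2$. Algebras over $F$ are nonassociative and without unit; write $(x,y,z)=(xy)z-x(yz)$, $[a,b]=ab-ba$, $a\circ b=ab+ba$, $aR_b=ab$. Let $\mathcal W^{(2)}$ be the variety of weakly Novikov, right symmetric, metabelian algebras over $F$, i.e. the variety defined by the identities $$(x,y,z)=(x,z,y),\qquad x(y,z,t)=(y,z,xt),\qquad (xy)(zt)=0,$$ and let $\mathfrak A$ be the free algebra of $\mathcal W^{(2)}$ on a countably infinite set $X$ of generators. Put $\mathrm{Tch}(x,y,z,t)=(xy,z,t)-(y,xz,t)-2(x,yz,t)$. (1) In $\mathfrak A$ the elements $(x,t_1,t_2)$, $(x,yt_1,t_2)$, $\mathrm{Tch}(x,t_1,t_2,t_3)$ and $(xt_1)R_{t_2}\cdots R_{t_k}$ ($k\ge 4$), with $x,y,t_i\in X$, are symmetric in the variables $t_i$, and $\mathfrak A$ has a basis formed by the elements $x$, $xy$, $x(yz)$, $(x,t_1,t_2)$, $(x,yt_1,t_2)$, $\mathrm{Tch}(x,t_1,t_2,t_3)$ and $(xt_1)R_{t_2}\cdots R_{t_k}$ ($k\ge4$), where $x,y,z$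 run over $X$ and $t_1,t_2,\dots$ over the unordered tuples (with repetitions allowed) of elements of $X$; different choices give different basis elements. (2) The multiplication of $\mathfrak A$ in this basis is as follows, for $x,y,z,t,t_i\in X$: \begin{align*} x\cdot y&=xy, & x\cdot yz&=x(yz),\\ x\cdot y(zt)&=-(x,zy,t), & x\cdot(y,t_1,t_2)&=(y,xt_1,t_2),\\ xz\cdot y&=(x,z,y)+x(zy), & x(zt)\cdot y&=(x,[z,t],y)+(z,xt,y),\\ (x,t_1,t_2)\cdot y&=\mathrm{Tch}(x,t_1,t_2,y)+(x,t_1\circ t_2,y), & \mathrm{Tch}(x,t_1,t_2,t_3)\cdot y&=(xt_1)R_{t_2}R_{t_3}R_y, \end{align*} $$(xt_1)R_{t_2}\cdots R_{t_k}\cdot y=(xt_1)R_{t_2}\cdots R_{t_k}R_y\quad(k\ge4),$$ and all other products of basis elements are $0$. (3) For an algebra $A$ put $A_L^1=A$ and let $A_L^{n+1}=A\cdot A_L^n$ be the span of all products $ab$ with $a\in A$, $b\in A_L^n$. Then $\mathcal W^{(2)}$ is left nilpotent of exact index $5$: $A_L^5=0$ for every $A\in\mathcal W^{(2)}$, while $\mathfrak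 A_L^4\ne0$. Its subvariety of Novikov metabelian algebras, distinguished by $x(yz)=y(xz)$, is also left nilpotent of exact index $5$: its free algebra $\mathfrak N$ on $X$ satisfies $\mathfrak N_L^5=0$ and $\mathfrak N_L^4\neq 0$. -/

import Mathlib

/-! Algebras here are nonassociative and without unit: an algebra over a field `F` is a
`NonUnitalNonAssocRing` that is an `F`-module with `F`-bilinear multiplication. -/

namespace WNM

section Ideals

variable (F : Type*) {A : Type*} [Field F] [NonUnitalNonAssocRing A] [Module F A]

/-- The (two-sided) ideal of the algebra `A` generated by a set `S`. -/
def idealSpan (S : Set A) : Submodule F A :=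
  sInf {I : Submodule F A | S ⊆ I ∧ ∀ a : A, ∀ x ∈ I, a * x ∈ I ∧ x * a ∈ I}

theorem mul_mem_idealSpan (S : Set A) (a : A) {x : A} (hx : x ∈ idealSpan F S) :
    a * x ∈ idealSpan F S ∧ x * a ∈ idealSpan F S := by
  simp only [idealSpan, Submodule.mem_sInf] at hx ⊢
  exact ⟨fun I hI => (hI.2 a x (hx I hI)).1, fun I hI => (hI.2 a x (hx I hI)).2⟩

/-- The quotient algebra of `A` by the ideal generated by `S`. -/
def Quo (S : Set A) : Type _ := A ⧸ idealSpan F S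

namespace Quo

variable (S : Set A)

instance : AddCommGroup (Quo F S) := inferInstanceAs (AddCommGroup (A ⧸ idealSpan F S))

instance : Module F (Quo F S) := inferInstanceAs (Module F (A ⧸ idealSpan F S))

/-- The quotient map. -/
def mk : A →ₗ[F] Quo F S := (idealSpan F S).mkQ

variable {S} in
theorem mk_surjective : Function.Surjective (mk F S) := (idealSpan F S).mkQ_surjective

variable {S} in
theorem mk_eq_mk {x y : A} : mk F S x = mk F S y ↔ x - y ∈ idealSpan F S :=
  Submodule.Quotient.eq (idealSpan F S)

instance : Mul (Quo F S) where
  mul := Quotient.map₂ (fun a b : A => a * b) (by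
    intro a a' ha b b' hb
    have ha' := (Submodule.quotientRel_def (idealSpan F S)).1 ha
    have hb' := (Submodule.quotientRel_def (idealSpan F S)).1 hb
    refine (Submodule.quotientRel_def (idealSpan F S)).2 ?_
    have h : a * b - a' * b' = (a - a') * b + a' * (b - b') := by
      rw [sub_mul, mul_sub]; abel
    rw [h]
    exact add_mem (mul_mem_idealSpan F S b ha').2 (mul_mem_idealSpan F S a' hb').1)

theorem mk_mul (a b : A) : mk F S (a * b) = mk F S a * mk F S b := rfl

instance : NonUnitalNonAssocRing (Quo F S) :=
  { (inferInstance : AddCommGroup (Quo F S)), (inferInstance : Mul (Quo F S)) with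
    left_distrib := by
      intro a b c
      obtain ⟨a, rfl⟩ := mk_surjective F a
      obtain ⟨b, rfl⟩ := mk_surjective F b
      obtain ⟨c, rfl⟩ := mk_surjective F c
      change mk F S a * (mk F S b + mk F S c) = mk F S a * mk F S b + mk F S a * mk F S c
      rw [← map_add, ← mk_mul, mul_add, map_add, mk_mul, mk_mul]
    right_distrib := by
      intro a b c
      obtain ⟨a, rfl⟩ := mk_surjective F a
      obtain ⟨b, rfl⟩ := mk_surjective F b
      obtain ⟨c, rfl⟩ := mk_surjective F c
      change (mk F S a + mk F S b) * mk F S c = mk F S a * mk F S c + mk F S b * mk F S c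
      rw [← map_add, ← mk_mul, add_mul, map_add, mk_mul, mk_mul]
    zero_mul := by
      intro a
      obtain ⟨a, rfl⟩ := mk_surjective F a
      change (0 : Quo F S) * mk F S a = 0
      rw [← map_zero (mk F S), ← mk_mul, zero_mul]
    mul_zero := by
      intro a
      obtain ⟨a, rfl⟩ := mk_surjective F a
      change mk F S a * (0 : Quo F S) = 0
      rw [← map_zero (mk F S), ← mk_mul, mul_zero] }

instance [IsScalarTower F A A] : IsScalarTower F (Quo F S) (Quo F S) where
  smul_assoc := by
    intro r a b
    obtain ⟨a, rfl⟩ := mk_surjective F a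
    obtain ⟨b, rfl⟩ := mk_surjective F b
    simp only [smul_eq_mul]
    rw [← map_smul, ← mk_mul, ← mk_mul, smul_mul_assoc, map_smul]

instance [SMulCommClass F A A] : SMulCommClass F (Quo F S) (Quo F S) where
  smul_comm := by
    intro r a b
    obtain ⟨a, rfl⟩ := mk_surjective F a
    obtain ⟨b, rfl⟩ := mk_surjective F b
    simp only [smul_eq_mul]
    rw [← map_smul, ← mk_mul, ← mk_mul, mul_smul_comm, map_smul]

end Quo

end Ideals

section Varieties

/-- The values in `A` of the identities defining the variety of weakly Novikov, right symmetric,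
metabelian algebras; `associator x y z = (x * y) * z - x * (y * z)`. -/
inductive WeaklyNovikovRel (A : Type*) [NonUnitalNonAssocRing A] : A → Prop
  /-- right symmetry: `(x,y,z) = (x,z,y)` -/
  | rightSymm (x y z : A) : WeaklyNovikovRel A (associator x y z - associator x z y)
  /-- weak Novikov identity: `x(y,z,t) = (y,z,xt)` -/
  | weaklyNovikov (x y z t : A) :
      WeaklyNovikovRel A (x * associator y z t - associator y z (x * t))
  /-- metabelian identity: `(xy)(zt) = 0` -/
  | metabelian (x y z t : A) : WeaklyNovikovRel A ((x * y) * (z * t))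

/-- The values in `A` of the identities defining the variety of Novikov metabelian algebras,
the subvariety of the previous one distinguished by left commutativity. -/
inductive NovikovRel (A : Type*) [NonUnitalNonAssocRing A] : A → Prop
  | weakly (a : A) : WeaklyNovikovRel A a → NovikovRel A a
  /-- left commutativity: `x(yz) = y(xz)` -/
  | leftComm (x y z : A) : NovikovRel A (x * (y * z) - y * (x * z))

/-- `A` is a weakly Novikov, right symmetric, metabelian algebra. -/
def IsWeaklyNovikovMetabelian (A : Type*) [NonUnitalNonAssocRing A] : Prop :=
  ∀ a : A, WeaklyNovikovRel A a → a = 0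

/-- The free algebra on `X` of the variety of weakly Novikov, right symmetric, metabelian algebras
over `F`: the free nonassociative algebra modulo the ideal generated by all values of the
defining identities. -/
abbrev FreeWN (F X : Type*) [Field F] : Type _ :=
  Quo F {r : FreeNonUnitalNonAssocAlgebra F X | WeaklyNovikovRel _ r}

/-- The free algebra on `X` of the variety of Novikov metabelian algebras over `F`. -/
abbrev FreeNov (F X : Type*) [Field F] : Type _ :=
  Quo F {r : FreeNonUnitalNonAssocAlgebra F X | NovikovRel _ r}

/-- The free generators of `FreeWN F X`. -/
noncomputable def FreeWN.of (F : Type*) {X : Type*} [Field F] (x : X) : FreeWN F X :=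
  Quo.mk F _ (FreeNonUnitalNonAssocAlgebra.of F x)

end Varieties

section LeftNilpotency

variable (F A : Type*) [Field F] [NonUnitalNonAssocRing A] [Module F A]

/-- The left powers of `A`: the first one is `A`, the `(n+1)`-st one is the span of all
products `a * b` with `a` in `A` and `b` in the `n`-th one (the `0`-th one is `A` by convention). -/
def leftPow : ℕ → Submodule F A
  | 0 => ⊤
  | 1 => ⊤
  | n + 2 => Submodule.span F {c | ∃ a : A, ∃ b ∈ leftPow (n + 1), c = a * b}

/-- `A` is left nilpotent of exact index `n`. -/
def IsLeftNilpotentOfIndex (n : ℕ) : Prop :=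
  leftPow F A n = ⊥ ∧ ∀ m < n, leftPow F A m ≠ ⊥

end LeftNilpotency

section Base

/-- `Tch(x,y,z,t) = (xy,z,t) - (y,xz,t) - 2(x,yz,t)`. -/
def Tch {A : Type*} [NonUnitalNonAssocRing A] (x y z t : A) : A :=
  associator (x * y) z t - associator y (x * z) t - (2 : ℕ) • associator x (y * z) t

/-- The word `(x t₁) R_{t₂} … R_{tₖ} = (…((x t₁) t₂) …) tₖ`, for a list `t₁, …, tₖ`. -/
def rWord {A : Type*} [NonUnitalNonAssocRing A] (x : A) (t : List A) : A :=
  t.foldl (fun w s => w * s) x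

/-- Labels of the base elements. Unordered tuples (with repetitions) label the groups of
variables in which a base element is symmetric. -/
inductive BaseIndex (X : Type*) : Type _
  /-- `x` -/
  | gen (x : X)
  /-- `xy` -/
  | prod (x y : X)
  /-- `x(yz)` -/
  | left (x y z : X)
  /-- `(x,t₁,t₂)` -/
  | assoc (x : X) (t : Sym2 X)
  /-- `(x,yt₁,t₂)` -/
  | assocProd (x y : X) (t : Sym2 X)
  /-- `Tch(x,t₁,t₂,t₃)` -/
  | tch (x : X) (t : Sym X 3)
  /-- `(xt₁)R_{t₂}…R_{tₖ}`, where `k ≥ 4` -/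
  | word (x : X) (t : Multiset X) (ht : 4 ≤ t.card)

open BaseIndex

variable {F X A : Type*} [Field F] [NonUnitalNonAssocRing A] [Module F A]

/-- The family `b` consists of the base elements written in the elements `g x` of `A`. In
particular each base element is symmetric in its variables `t`. -/
structure IsBaseFamily (g : X → A) (b : BaseIndex X → A) : Prop where
  gen (x : X) : b (gen x) = g x
  prod (x y : X) : b (prod x y) = g x * g y
  left (x y z : X) : b (left x y z) = g x * (g y * g z)
  assoc (x t₁ t₂ : X) : b (assoc x s(t₁, t₂)) = associator (g x) (g t₁) (g t₂)
  assocProd (x y t₁ t₂ : X) :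
    b (assocProd x y s(t₁, t₂)) = associator (g x) (g y * g t₁) (g t₂)
  tch (x t₁ t₂ t₃ : X) :
    b (tch x (t₁ ::ₛ t₂ ::ₛ t₃ ::ₛ Sym.nil)) = Tch (g x) (g t₁) (g t₂) (g t₃)
  word (x : X) (t : List X) (ht : 4 ≤ (t : Multiset X).card) :
    b (word x t ht) = rWord (g x) (t.map g)

/-- The pairs of base elements whose products are listed explicitly in the multiplication table. -/
inductive Listed : BaseIndex X → BaseIndex X → Prop
  | gen_gen (x y : X) : Listed (gen x) (gen y)
  | gen_prod (x y z : X) : Listed (gen x) (prod y z)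
  | gen_left (x y z t : X) : Listed (gen x) (left y z t)
  | gen_assoc (x y : X) (t : Sym2 X) : Listed (gen x) (assoc y t)
  | prod_gen (x z y : X) : Listed (prod x z) (gen y)
  | left_gen (x z t y : X) : Listed (left x z t) (gen y)
  | assoc_gen (x : X) (t : Sym2 X) (y : X) : Listed (assoc x t) (gen y)
  | tch_gen (x : X) (t : Sym X 3) (y : X) : Listed (tch x t) (gen y)
  | word_gen (x : X) (t : Multiset X) (ht : 4 ≤ t.card) (y : X) : Listed (word x t ht) (gen y)

/-- The multiplication table of the base elements. -/
structure HasMulTable (b : BaseIndex X → A) : Prop where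
  /-- `x · y = xy` -/
  gen_gen (x y : X) : b (gen x) * b (gen y) = b (prod x y)
  /-- `x · yz = x(yz)` -/
  gen_prod (x y z : X) : b (gen x) * b (prod y z) = b (left x y z)
  /-- `x · y(zt) = -(x,zy,t)` -/
  gen_left (x y z t : X) : b (gen x) * b (left y z t) = -b (assocProd x z s(y, t))
  /-- `x · (y,t₁,t₂) = (y,xt₁,t₂)` -/
  gen_assoc (x y t₁ t₂ : X) :
    b (gen x) * b (assoc y s(t₁, t₂)) = b (assocProd y x s(t₁, t₂))
  /-- `xz · y = (x,z,y) + x(zy)` -/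
  prod_gen (x z y : X) : b (prod x z) * b (gen y) = b (assoc x s(z, y)) + b (left x z y)
  /-- `x(zt) · y = (x,[z,t],y) + (z,xt,y)` -/
  left_gen (x z t y : X) :
    b (left x z t) * b (gen y) =
      (b (assocProd x z s(t, y)) - b (assocProd x t s(z, y))) + b (assocProd z x s(t, y))
  /-- `(x,t₁,t₂) · y = Tch(x,t₁,t₂,y) + (x,t₁∘t₂,y)`, where `t₁∘t₂ = t₁t₂ + t₂t₁` -/
  assoc_gen (x t₁ t₂ y : X) :
    b (assoc x s(t₁, t₂)) * b (gen y) =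
      b (tch x (t₁ ::ₛ t₂ ::ₛ y ::ₛ Sym.nil)) +
        (b (assocProd x t₁ s(t₂, y)) + b (assocProd x t₂ s(t₁, y)))
  /-- `Tch(x,t₁,t₂,t₃) · y = (xt₁)R_{t₂}R_{t₃}R_y` -/
  tch_gen (x t₁ t₂ t₃ y : X) :
    b (tch x (t₁ ::ₛ t₂ ::ₛ t₃ ::ₛ Sym.nil)) * b (gen y) =
      b (word x ([t₁, t₂, t₃, y] : List X) (le_refl 4))
  /-- `(xt₁)R_{t₂}…R_{tₖ} · y = (xt₁)R_{t₂}…R_{tₖ}R_y` -/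
  word_gen (x : X) (t : Multiset X) (ht : 4 ≤ t.card) (y : X) :
    b (word x t ht) * b (gen y) =
      b (word x (y ::ₘ t) (ht.trans (Multiset.card_le_card (Multiset.le_cons_self t y))))
  /-- all the other products of base elements are zero -/
  other (i j : BaseIndex X) : ¬ Listed i j → b i * b j = 0

end Base

end WNM

/-! The basis is found by bounding the free algebra from both sides. Upper bound: in any algebra $A$
of the variety, right symmetry turns the weak Novikov identity into $(x,yz,t)=y(x,z,t)$, which is
symmetric in $z,t$, and metabelianity gives $x(y(zt))=-(x,zy,t)$. Substituting these in the
Teichmüller identity computes $(x,s,t)y$ as $\mathrm{Tch}(x,s,t,y)$ plus elements $(x,yz,t)$, which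
are annihilated on both sides. So `Tch` is symmetric in its last three arguments, and from degree
five on only right multiplications survive; these commute on $A^2$. Hence the base elements are well
defined and satisfy the table (`hasMulTable`), so their span is closed under multiplication and
contains the generators. Lower bound: the table itself is used to define an algebra on the vector
space with basis `BaseIndex X`. It belongs to the variety (`Model.isWeaklyNovikovMetabelian`) and
its basis vectors are the base elements in its generators (`Model.isBaseFamily_basis`). The
homomorphism from the free algebra therefore sends the base family to a basis, which forces linear
independence. Nilpotency: $a(b(c(de)))=-a(b,dc,e)=0$ gives index at most five. The bound is attained
in a five-dimensional Novikov metabelian algebra with $e(e(ee))\ne0$, onto whose generator $e$ both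
free algebras map their generators. -/

namespace WNM

/-! ### Consequences of the defining identities -/

section Identities

variable {A : Type*} [NonUnitalNonAssocRing A]

variable (A) in
/-- The additive subgroup generated by the products of two elements of `A`. -/
def sq : AddSubgroup A := AddSubgroup.closure {c | ∃ a b : A, a * b = c}

theorem mul_mem_sq (a b : A) : a * b ∈ sq A := AddSubgroup.subset_closure ⟨a, b, rfl⟩

theorem associator_mem_sq (a b c : A) : associator a b c ∈ sq A :=
  sub_mem (mul_mem_sq _ _) (mul_mem_sq _ _)

theorem tch_mem_sq (a b c d : A) : Tch a b c d ∈ sq A :=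
  sub_mem (sub_mem (associator_mem_sq _ _ _) (associator_mem_sq _ _ _))
    (nsmul_mem (associator_mem_sq _ _ _) 2)

theorem rWord_mem_sq {v : A} (hv : v ∈ sq A) (l : List A) : rWord v l ∈ sq A := by
  induction l generalizing v with
  | nil => exact hv
  | cons s l ih => exact ih (mul_mem_sq v s)

/-- The element `Tch(x,s,t,u)` for a list `s, t, u` of length three. -/
def tchList (x : A) : List A → A
  | [s, t, u] => Tch x s t u
  | _ => 0

/-- Permutations are generated by adjacent transpositions. Quantifying over a prefix `p` lets the
induction move a common head into it. -/
theorem perm_invariant {α β : Type*} (f : List α → β)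
    (hf : ∀ p a b q, f (p ++ a :: b :: q) = f (p ++ b :: a :: q)) {l l' : List α}
    (h : l.Perm l') : f l = f l' := by
  suffices ∀ p, f (p ++ l) = f (p ++ l') from this []
  induction h with
  | nil => exact fun _ => rfl
  | cons a _ ih => exact fun p => by simpa using ih (p ++ [a])
  | swap a b l => exact fun p => hf p b a l
  | trans _ _ ih ih' => exact fun p => (ih p).trans (ih' p)

theorem exists_eq_cons₃ {X : Type*} (t : Sym X 3) :
    ∃ a b c, t = a ::ₛ b ::ₛ c ::ₛ Sym.nil := by
  obtain ⟨a, t, rfl⟩ := t.exists_eq_cons_of_succ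
  obtain ⟨b, t, rfl⟩ := t.exists_eq_cons_of_succ
  obtain ⟨c, t, rfl⟩ := t.exists_eq_cons_of_succ
  exact ⟨a, b, c, by rw [Sym.eq_nil_of_card_zero t]⟩

namespace IsWeaklyNovikovMetabelian

variable (hA : IsWeaklyNovikovMetabelian A)
include hA

theorem associator_comm (x y z : A) : associator x y z = associator x z y :=
  sub_eq_zero.1 (hA _ (.rightSymm x y z))

theorem mul_associator (x y z t : A) : x * associator y z t = associator y z (x * t) :=
  sub_eq_zero.1 (hA _ (.weaklyNovikov x y z t))

theorem mul_mul_mul (x y z t : A) : x * y * (z * t) = 0 := hA _ (.metabelian x y z t)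

theorem associator_mul_mid (x y z t : A) : associator x (y * z) t = y * associator x z t := by
  rw [hA.associator_comm, ← hA.mul_associator, hA.associator_comm]

theorem associator_mul_mid_comm (x y z t : A) :
    associator x (y * z) t = associator x (y * t) z := by
  rw [hA.associator_mul_mid, hA.associator_comm, ← hA.associator_mul_mid]

/-- Symmetry gives $(x,zy,t)=(x,zt,y)=(x,y,zt)$, and the first term $(xy)(zt)$ of the last
associator is zero. -/
theorem mul_mul_mul_right (x y z t : A) : x * (y * (z * t)) = -associator x (z * y) t := by
  rw [hA.associator_mul_mid_comm, hA.associator_comm, associator_apply, hA.mul_mul_mul]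
  simp

theorem left_mul (x z t y : A) :
    x * (z * t) * y =
      associator x (z * t) y - associator x (t * z) y + associator z (x * t) y := by
  have h : z * t * y = associator z t y + z * (t * y) := by rw [associator_apply]; abel
  have h' : x * (z * t) * y = associator x (z * t) y + x * (z * t * y) := by
    rw [associator_apply]; abel
  rw [h', h, mul_add, ← hA.associator_mul_mid, hA.mul_mul_mul_right]
  abel

/-- This is the Teichmüller identity $(xs,t,y)-(x,st,y)+(x,s,ty)=x(s,t,y)+(x,s,t)y$, valid in every
algebra, with $(x,s,ty)=(x,ts,y)$ and $x(s,t,y)=(s,xt,y)$. The terms are grouped so that the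
remainder is `Tch`. -/
theorem associator_mul (x s t y : A) :
    associator x s t * y =
      Tch x s t y + (associator x (s * t) y + associator x (t * s) y) := by
  have h : associator (x * s) t y - associator x (s * t) y + associator x s (t * y) =
      x * associator s t y + associator x s t * y := by
    simp only [associator_apply, mul_sub, sub_mul]; abel
  rw [hA.associator_comm x s, hA.associator_mul_mid_comm x t, ← hA.associator_mul_mid] at h
  rw [← sub_eq_iff_eq_add'.2 h, Tch]
  abel

theorem associator_mul_mul (x y z s t : A) : associator x (y * z) (s * t) = 0 := by
  rw [associator_apply, hA.mul_mul_mul, hA.mul_mul_mul, mul_zero, sub_zero]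

theorem mul_associator_mul (w x y z t : A) : w * associator x (y * z) t = 0 := by
  rw [hA.mul_associator, hA.associator_mul_mul]

theorem tch_swap_right (x s t u : A) : Tch x s t u = Tch x s u t := by
  rw [Tch, Tch, hA.associator_comm (x * s), hA.associator_mul_mid_comm s,
    hA.associator_mul_mid_comm x]

theorem tch_eq (x s t u : A) :
    Tch x s t u = associator x s t * u - (associator x (s * t) u + associator x (t * s) u) :=
  eq_sub_of_add_eq (hA.associator_mul x s t u).symm

/-- The definition only shows symmetry in the last two arguments; the expression in `tch_eq` is
visibly symmetric in $s,t$. Together the two swaps generate all permutations. -/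
theorem tch_swap_left (x s t u : A) : Tch x s t u = Tch x t s u := by
  rw [hA.tch_eq, hA.tch_eq, hA.associator_comm x s, add_comm]

theorem associator_mul_mul_mul (x y s t u : A) : associator x y s * (t * u) = 0 := by
  rw [associator_apply, sub_mul, hA.mul_mul_mul, hA.mul_mul_mul, sub_zero]

/-- By symmetry the product $yz$ can be moved to the last argument of `Tch`, where every term of
`tch_eq` vanishes. The other terms of $(x,yz,t)w$ are $(yz)(x,t,w)$ and $t(x,yz,w)$, both zero. -/
theorem associator_mul_mid_mul (x y z t w : A) : associator x (y * z) t * w = 0 := by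
  have h : Tch x (y * z) t w = 0 := by
    rw [hA.tch_swap_left, hA.tch_swap_right, hA.tch_eq, hA.associator_mul_mul,
      hA.associator_mul_mul, hA.associator_mul_mul_mul]
    simp
  rw [hA.associator_mul, h, hA.associator_mul_mid x t, hA.mul_associator_mul,
    hA.associator_mul_mid x, associator_apply, mul_sub, hA.mul_mul_mul, hA.mul_mul_mul]
  simp

theorem mul_tch (w x s t u : A) : w * Tch x s t u = 0 := by
  rw [Tch, mul_sub, mul_sub, mul_smul_comm, hA.mul_associator_mul, hA.mul_associator_mul,
    hA.mul_associator, hA.associator_comm, associator_apply, hA.mul_mul_mul, hA.mul_mul_mul]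
  simp

theorem mul_eq_zero_of_mem_sq {u v : A} (hu : u ∈ sq A) (hv : v ∈ sq A) : u * v = 0 := by
  induction hu using AddSubgroup.closure_induction with
  | mem u h =>
    obtain ⟨a, b, rfl⟩ := h
    induction hv using AddSubgroup.closure_induction with
    | mem v h =>
      obtain ⟨c, d, rfl⟩ := h
      exact hA.mul_mul_mul a b c d
    | zero => exact mul_zero _
    | add _ _ _ _ h h' => rw [mul_add, h, h', add_zero]
    | neg _ _ h => rw [mul_neg, h, neg_zero]
  | zero => exact zero_mul _
  | add _ _ _ _ h h' => rw [add_mul, h, h', add_zero]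
  | neg _ _ h => rw [neg_mul, h, neg_zero]

theorem mul_right_comm_of_mem_sq {v : A} (hv : v ∈ sq A) (s t : A) : v * s * t = v * t * s := by
  have h := hA.associator_comm v s t
  rwa [associator_apply, associator_apply, hA.mul_eq_zero_of_mem_sq hv (mul_mem_sq s t),
    hA.mul_eq_zero_of_mem_sq hv (mul_mem_sq t s), sub_zero, sub_zero] at h

/-- Expanding $((xs)t)u$ gives $\mathrm{Tch}(x,s,t,u)$ plus associators with a product in the
middle, and right multiplication by $v$ kills the latter. -/
theorem mul_mul_mul_mul (x s t u v : A) : x * s * t * u * v = Tch x s t u * v := by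
  have h : x * s * t = associator x s t + x * (s * t) := by rw [associator_apply]; abel
  rw [h, add_mul, hA.associator_mul, hA.left_mul]
  simp only [add_mul, sub_mul, hA.associator_mul_mid_mul]
  simp

/-- In $(a,v,s)=(a,s,v)$ every term except $a(vs)$ is a left multiple of $v$ or contains one. So the
elements annihilated by all left multiplications are stable under right multiplications, which
handles words of any length. -/
theorem mul_mul_eq_zero {v : A} (h : ∀ a, a * v = 0) (a s : A) :
    a * (v * s) = 0 := by
  have h1 := hA.associator_comm a v s
  rw [associator_apply, associator_apply, h, h, h, zero_mul, mul_zero,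
    zero_sub, sub_zero] at h1
  exact neg_eq_zero.1 h1

theorem mul_rWord_eq_zero {v : A} (h : ∀ a, a * v = 0) (a : A) (l : List A) :
    a * rWord v l = 0 := by
  induction l generalizing v with
  | nil => exact h a
  | cons s l ih => exact ih fun a => hA.mul_mul_eq_zero h a s

theorem mul_rWord (w x : A) {l : List A} (hl : 4 ≤ l.length) : w * rWord x l = 0 := by
  match l, hl with
  | a :: b :: c :: d :: l, _ =>
    change w * rWord (x * a * b * c * d) l = 0
    rw [hA.mul_mul_mul_mul]
    exact hA.mul_rWord_eq_zero
      (fun e => hA.mul_mul_eq_zero (fun f => hA.mul_tch _ _ _ _ _) _ _) _ _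

theorem rWord_swap (x : A) (p : List A) (s t : A) (q : List A)
    (h : 4 ≤ (p ++ s :: t :: q).length) :
    rWord x (p ++ s :: t :: q) = rWord x (p ++ t :: s :: q) := by
  rcases p with _ | ⟨a, p⟩
  -- The first two letters are not covered by commuting right multiplications on $A^2$, since $x$
  -- need not lie in $A^2$. The symmetry of `Tch` is used instead, which needs two further letters.
  · match q, h with
    | c :: d :: q, _ =>
      change rWord (x * s * t * c * d) q = rWord (x * t * s * c * d) q
      rw [hA.mul_mul_mul_mul, hA.tch_swap_left, ← hA.mul_mul_mul_mul]
  · have h : rWord (x * a) p * s * t = rWord (x * a) p * t * s :=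
      hA.mul_right_comm_of_mem_sq (rWord_mem_sq (mul_mem_sq x a) p) s t
    simp only [rWord, List.foldl_append, List.foldl_cons, List.cons_append] at h ⊢
    rw [h]

theorem rWord_perm (x : A) {l l' : List A} (h : l.Perm l') (hl : 4 ≤ l.length) :
    rWord x l = rWord x l' := by
  -- Words of length below four are not symmetric, so they are replaced by the default value `0` to
  -- obtain an invariant function on all lists.
  have := perm_invariant (fun l : List A => if 4 ≤ l.length then rWord x l else 0)
    (fun p s t q => by
      by_cases h4 : 4 ≤ (p ++ s :: t :: q).length
      · have h4' : 4 ≤ (p ++ t :: s :: q).length := by simpa using h4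
        simp only [if_pos h4, if_pos h4', hA.rWord_swap x p s t q h4]
      · have h4' : ¬ 4 ≤ (p ++ t :: s :: q).length := by simpa using h4
        simp only [if_neg h4, if_neg h4']) h
  simpa only [if_pos hl, if_pos (h.length_eq ▸ hl)] using this

theorem tchList_perm (x : A) {l l' : List A} (h : l.Perm l') : tchList x l = tchList x l' := by
  refine perm_invariant (tchList x) (fun p s t q => ?_) h
  match p, q with
  | [], [] => rfl
  | [], [c] => exact hA.tch_swap_left x s t c
  | [], _ :: _ :: _ => rfl
  | [a], [] => exact hA.tch_swap_right x a s t
  | [a], _ :: _ => rfl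
  | _ :: _ :: [], _ => rfl
  | [_, _, _], _ => rfl
  | _ :: _ :: _ :: _ :: _, _ => rfl

end IsWeaklyNovikovMetabelian

end Identities

/-! ### The base elements and their multiplication table -/

section BaseFamily

open BaseIndex

variable {X A : Type*} [NonUnitalNonAssocRing A]

/-- The base elements written in the elements `g x` of `A`. -/
noncomputable def baseFamily (hA : IsWeaklyNovikovMetabelian A) (g : X → A) : BaseIndex X → A
  | gen x => g x
  | prod x y => g x * g y
  | left x y z => g x * (g y * g z)
  | assoc x t =>
      t.lift ⟨fun s t => associator (g x) (g s) (g t), fun _ _ => hA.associator_comm _ _ _⟩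
  | assocProd x y t =>
      t.lift ⟨fun s t => associator (g x) (g y * g s) (g t),
        fun _ _ => hA.associator_mul_mid_comm _ _ _ _⟩
  | tch x t => tchList (g x) (t.1.toList.map g)
  | word x t _ => rWord (g x) (t.toList.map g)

variable (hA : IsWeaklyNovikovMetabelian A) (g : X → A)

theorem isBaseFamily_baseFamily : IsBaseFamily g (baseFamily hA g) where
  gen _ := rfl
  prod _ _ := rfl
  left _ _ _ := rfl
  assoc _ _ _ := rfl
  assocProd _ _ _ _ := rfl
  tch x t₁ t₂ t₃ := by
    have h : (Multiset.toList (t₁ ::ₘ t₂ ::ₘ t₃ ::ₘ 0)).Perm [t₁, t₂, t₃] :=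
      Multiset.coe_eq_coe.1 (Multiset.coe_toList _)
    exact hA.tchList_perm (g x) (h.map g)
  word x t ht := by
    have h : (Multiset.toList (t : Multiset X)).Perm t :=
      Multiset.coe_eq_coe.1 (Multiset.coe_toList _)
    exact hA.rWord_perm (g x) (h.map g) (by simpa using ht)

namespace IsBaseFamily

variable {g} {b : BaseIndex X → A} (hb : IsBaseFamily g b)
include hb

theorem mem_sq (i : BaseIndex X) : (∃ x, i = .gen x) ∨ b i ∈ sq A := by
  match i with
  | .gen x => exact .inl ⟨x, rfl⟩
  | .prod x y => exact .inr (hb.prod x y ▸ mul_mem_sq _ _)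
  | .left x y z => exact .inr (hb.left x y z ▸ mul_mem_sq _ _)
  | .assoc x t =>
    induction t with
    | _ s t => exact .inr (hb.assoc x s t ▸ associator_mem_sq _ _ _)
  | .assocProd x y t =>
    induction t with
    | _ s t => exact .inr (hb.assocProd x y s t ▸ associator_mem_sq _ _ _)
  | .tch x t =>
    obtain ⟨a, b, c, rfl⟩ := exists_eq_cons₃ t
    exact .inr (hb.tch x a b c ▸ tch_mem_sq _ _ _ _)
  | .word x t ht =>
    induction t using Quot.inductionOn with
    | _ l =>
      refine .inr ((hb.word x l ht).symm ▸ ?_)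
      match l, ht with
      | a :: l, _ => exact rWord_mem_sq (mul_mem_sq _ _) _

include hA

theorem hasMulTable : HasMulTable b where
  gen_gen x y := by rw [hb.gen, hb.gen, hb.prod]
  gen_prod x y z := by rw [hb.gen, hb.prod, hb.left]
  gen_left x y z t := by rw [hb.gen, hb.left, hb.assocProd, hA.mul_mul_mul_right]
  gen_assoc x y t₁ t₂ := by
    rw [hb.gen, hb.assoc, hb.assocProd, hA.associator_mul_mid]
  prod_gen x z y := by
    rw [hb.gen, hb.prod, hb.assoc, hb.left, associator_apply]; abel
  left_gen x z t y := by
    rw [hb.gen, hb.left, hb.assocProd, hb.assocProd, hb.assocProd, hA.left_mul]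
  assoc_gen x t₁ t₂ y := by
    rw [hb.gen, hb.assoc, hb.tch, hb.assocProd, hb.assocProd, hA.associator_mul]
  tch_gen x t₁ t₂ t₃ y := by
    rw [hb.gen, hb.tch, ← hA.mul_mul_mul_mul]
    exact (hb.word x [t₁, t₂, t₃, y] (le_refl 4)).symm
  word_gen x t ht y := by
    induction t using Quot.inductionOn with
    | _ l =>
      -- Right multiplication appends $y$ at the end of the word, while the table puts it at the
      -- front of the multiset.
      have h : ((l ++ [y] : List X) : Multiset X) = y ::ₘ (l : Multiset X) :=
        Multiset.coe_eq_coe.2 (List.perm_append_comm (l₂ := [y]))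
      have h' : b (.word x (l ++ [y] : List X) (by rw [h]; exact ht.trans (by simp))) =
          b (.word x (y ::ₘ (l : Multiset X))
            (ht.trans (Multiset.card_le_card (Multiset.le_cons_self _ y)))) := by
        congr 2
      refine Eq.trans ?_ h'
      rw [hb.word, hb.gen]
      refine Eq.trans (congrArg (· * g y) (hb.word x l ht)) ?_
      simp [rWord]
  other i j hij := by
    rcases hb.mem_sq i with ⟨x, rfl⟩ | hi
    · match j with
      | .gen y => exact (hij (.gen_gen _ _)).elim
      | .prod _ _ => exact (hij (.gen_prod _ _ _)).elim
      | .left _ _ _ => exact (hij (.gen_left _ _ _ _)).elim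
      | .assoc _ _ => exact (hij (.gen_assoc _ _ _)).elim
      | .assocProd y z t =>
        induction t with
        | _ s t => rw [hb.assocProd, hA.mul_associator_mul]
      | .tch y t =>
        obtain ⟨a, b, c, rfl⟩ := exists_eq_cons₃ t
        rw [hb.tch, hA.mul_tch]
      | .word y t ht =>
        induction t using Quot.inductionOn with
        | _ l =>
          refine (congrArg (_ * ·) (hb.word y l ht)).trans (hA.mul_rWord _ _ ?_)
          simpa using ht
    · rcases hb.mem_sq j with ⟨y, rfl⟩ | hj
      · match i with
        | .gen _ => exact (hij (.gen_gen _ _)).elim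
        | .prod _ _ => exact (hij (.prod_gen _ _ _)).elim
        | .left _ _ _ => exact (hij (.left_gen _ _ _ _)).elim
        | .assoc _ _ => exact (hij (.assoc_gen _ _ _)).elim
        | .assocProd x z t =>
          induction t with
          | _ s t => rw [hb.assocProd, hA.associator_mul_mid_mul]
        | .tch _ _ => exact (hij (.tch_gen _ _ _)).elim
        | .word _ _ _ => exact (hij (.word_gen _ _ _ _)).elim
      · exact hA.mul_eq_zero_of_mem_sq hi hj

end IsBaseFamily

end BaseFamily

open BaseIndex

/-! ### The algebra defined by the multiplication table -/

section Model

variable (F X : Type*) [Field F]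

/-- The vector space with basis `BaseIndex X`. -/
def Model : Type _ := BaseIndex X →₀ F

namespace Model

noncomputable instance : AddCommGroup (Model F X) := inferInstanceAs (AddCommGroup (_ →₀ F))

noncomputable instance : Module F (Model F X) := inferInstanceAs (Module F (_ →₀ F))

/-- The standard basis of the model. -/
noncomputable def basis : Module.Basis (BaseIndex X) F (Model F X) :=
  (Finsupp.basisSingleOne : Module.Basis (BaseIndex X) F (BaseIndex X →₀ F))

/-- The element `(x,t₁,t₂) · y`. -/
noncomputable def assocMul (x t₁ t₂ y : X) : Model F X :=
  basis F X (tch x (t₁ ::ₛ t₂ ::ₛ y ::ₛ Sym.nil)) +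
    (basis F X (assocProd x t₁ s(t₂, y)) + basis F X (assocProd x t₂ s(t₁, y)))

theorem assocMul_comm (x t₁ t₂ y : X) : assocMul F X x t₁ t₂ y = assocMul F X x t₂ t₁ y := by
  rw [assocMul, assocMul, Sym.cons_swap, add_comm (basis F X (assocProd x t₁ _))]

/-- The multiplication table of the base elements. -/
noncomputable def tableMul : BaseIndex X → BaseIndex X → Model F X
  | gen x, gen y => basis F X (prod x y)
  | gen x, prod y z => basis F X (left x y z)
  | gen x, left y z t => -basis F X (assocProd x z s(y, t))
  | gen x, assoc y t => basis F X (assocProd y x t)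
  | prod x z, gen y => basis F X (assoc x s(z, y)) + basis F X (left x z y)
  | left x z t, gen y => (basis F X (assocProd x z s(t, y)) - basis F X (assocProd x t s(z, y))) +
      basis F X (assocProd z x s(t, y))
  | assoc x t, gen y =>
      t.lift ⟨fun t₁ t₂ => assocMul F X x t₁ t₂ y, fun _ _ => assocMul_comm F X _ _ _ _⟩
  | tch x t, gen y => basis F X (word x (y ::ₘ t.1) (by simp))
  | word x t ht, gen y => basis F X (word x (y ::ₘ t) (by simp; lia))
  | _, _ => 0

/-- The multiplication of the model, as a bilinear map. -/
noncomputable def mulHom : Model F X →ₗ[F] Model F X →ₗ[F] Model F X :=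
  (basis F X).constr F fun i => (basis F X).constr F fun j => tableMul F X i j

noncomputable instance : Mul (Model F X) := ⟨fun a b => mulHom F X a b⟩

variable {F X}

theorem mul_def (a b : Model F X) : a * b = mulHom F X a b := rfl

noncomputable instance : NonUnitalNonAssocRing (Model F X) :=
  { (inferInstance : AddCommGroup (Model F X)), (inferInstance : Mul (Model F X)) with
    left_distrib a b c := by simp only [mul_def, map_add]
    right_distrib a b c := by simp only [mul_def, map_add, LinearMap.add_apply]
    zero_mul a := by simp only [mul_def, map_zero, LinearMap.zero_apply]
    mul_zero a := by simp only [mul_def, map_zero] }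

instance : IsScalarTower F (Model F X) (Model F X) where
  smul_assoc r a b := by
    simp only [smul_eq_mul, mul_def, map_smul, LinearMap.smul_apply]

instance : SMulCommClass F (Model F X) (Model F X) where
  smul_comm r a b := by simp only [smul_eq_mul, mul_def, map_smul]

theorem basis_mul (i j : BaseIndex X) : basis F X i * basis F X j = tableMul F X i j := by
  rw [mul_def, mulHom, Module.Basis.constr_basis, Module.Basis.constr_basis]

theorem hasMulTable : HasMulTable (basis F X) where
  gen_gen x y := basis_mul _ _
  gen_prod x y z := basis_mul _ _
  gen_left x y z t := basis_mul _ _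
  gen_assoc x y t₁ t₂ := basis_mul _ _
  prod_gen x z y := basis_mul _ _
  left_gen x z t y := basis_mul _ _
  assoc_gen x t₁ t₂ y := basis_mul _ _
  tch_gen x t₁ t₂ t₃ y := by
    have h : (([t₁, t₂, t₃, y] : List X) : Multiset X) =
        y ::ₘ ((t₁ ::ₛ t₂ ::ₛ t₃ ::ₛ Sym.nil : Sym X 3) : Multiset X) :=
      Multiset.coe_eq_coe.2 (List.perm_append_comm (l₁ := [t₁, t₂, t₃]) (l₂ := [y]))
    rw [basis_mul]
    change basis F X (word _ _ _) = _
    congr 2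
    exact h.symm
  word_gen x t ht y := basis_mul _ _
  other i j hij := by
    rw [basis_mul]
    cases i <;> cases j <;> first | rfl | exact (hij (by constructor)).elim

variable (F X) in
/-- The span of the base elements of degree at least two. -/
noncomputable def decomposables : Submodule F (Model F X) :=
  Submodule.span F {v | ∃ i, (∀ x, i ≠ gen x) ∧ basis F X i = v}

theorem basis_mem {i : BaseIndex X} (h : ∀ x, i ≠ gen x) : basis F X i ∈ decomposables F X :=
  Submodule.subset_span ⟨i, h, rfl⟩

/-- The model is the sum of the span of the generators and `decomposables`, so a multilinear
identity need only be checked with each argument a generator or decomposable. As decomposables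
multiply to zero, few cases remain. -/
theorem induction {p : Model F X → Prop} (add : ∀ a b, p a → p b → p (a + b))
    (smul : ∀ (r : F) a, p a → p (r • a)) (gen : ∀ x, p (basis F X (gen x)))
    (dec : ∀ v ∈ decomposables F X, p v) (a : Model F X) : p a := by
  induction (basis F X).mem_span a using Submodule.span_induction with
  | mem v hv =>
    obtain ⟨i, rfl⟩ := hv
    by_cases h : ∃ x, i = .gen x
    · obtain ⟨x, rfl⟩ := h
      exact gen x
    · exact dec _ (basis_mem (by simpa using h))
  | zero => exact dec 0 (zero_mem _)
  | add a b _ _ ha hb => exact add a b ha hb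
  | smul r a _ ha => exact smul r a ha

theorem decomposables_induction {p : ∀ v, v ∈ decomposables F X → Prop} (zero : p 0 (zero_mem _))
    (add : ∀ a b ha hb, p a ha → p b hb → p (a + b) (add_mem ha hb))
    (smul : ∀ (r : F) a ha, p a ha → p (r • a) (Submodule.smul_mem _ r ha))
    (prod : ∀ x y, p (basis F X (prod x y)) (basis_mem (by simp)))
    (left : ∀ x y z, p (basis F X (left x y z)) (basis_mem (by simp)))
    (assoc : ∀ x s t, p (basis F X (assoc x s(s, t))) (basis_mem (by simp)))
    (assocProd : ∀ x y s t, p (basis F X (assocProd x y s(s, t))) (basis_mem (by simp)))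
    (tch : ∀ x s t u, p (basis F X (tch x (s ::ₛ t ::ₛ u ::ₛ Sym.nil))) (basis_mem (by simp)))
    (word : ∀ x t ht, p (basis F X (word x t ht)) (basis_mem (by simp))) {v : Model F X}
    (hv : v ∈ decomposables F X) : p v hv := by
  induction hv using Submodule.span_induction with
  | mem v hv =>
    obtain ⟨i, hi, rfl⟩ := hv
    match i with
    | .gen x => exact (hi x rfl).elim
    | .prod x y => exact prod x y
    | .left x y z => exact left x y z
    | .assoc x t => induction t with | _ s t => exact assoc x s t
    | .assocProd x y t => induction t with | _ s t => exact assocProd x y s t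
    | .tch x t =>
      obtain ⟨a, b, c, rfl⟩ := exists_eq_cons₃ t
      exact tch x a b c
    | .word x t ht => exact word x t ht
  | zero => exact zero
  | add a b _ _ ha hb => exact add a b _ _ ha hb
  | smul r a _ ha => exact smul r a _ ha

theorem tableMul_mem (i j : BaseIndex X) : tableMul F X i j ∈ decomposables F X := by
  have h {i : BaseIndex X} (h : ∀ x, i ≠ gen x := by simp) := basis_mem (F := F) h
  cases i with
  | assoc x t =>
    induction t with
    | _ s t =>
      cases j
      case gen y => exact add_mem h (add_mem h h)
      all_goals exact zero_mem _
  | gen x =>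
    cases j
    case left => exact neg_mem h
    all_goals first | exact zero_mem _ | exact h
  | prod =>
    cases j
    case gen => exact add_mem h h
    all_goals exact zero_mem _
  | left =>
    cases j
    case gen => exact add_mem (sub_mem h h) h
    all_goals exact zero_mem _
  | _ => cases j <;> first | exact zero_mem _ | exact h

theorem mul_mem (a b : Model F X) : a * b ∈ decomposables F X := by
  induction (basis F X).mem_span a using Submodule.span_induction with
  | mem v hv =>
    obtain ⟨i, rfl⟩ := hv
    induction (basis F X).mem_span b using Submodule.span_induction with
    | mem v hv =>
      obtain ⟨j, rfl⟩ := hv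
      exact basis_mul (F := F) i j ▸ tableMul_mem i j
    | zero => rw [mul_zero]; exact zero_mem _
    | add _ _ _ _ h h' => rw [mul_add]; exact add_mem h h'
    | smul r _ _ h => rw [mul_smul_comm]; exact Submodule.smul_mem _ _ h
  | zero => rw [zero_mul]; exact zero_mem _
  | add _ _ _ _ h h' => rw [add_mul]; exact add_mem h h'
  | smul r _ _ h => rw [smul_mul_assoc]; exact Submodule.smul_mem _ _ h

theorem mul_eq_zero_of_mem {u v : Model F X} (hu : u ∈ decomposables F X)
    (hv : v ∈ decomposables F X) : u * v = 0 := by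
  induction hu using Submodule.span_induction with
  | mem u hu =>
    obtain ⟨i, hi, rfl⟩ := hu
    induction hv using Submodule.span_induction with
    | mem v hv =>
      obtain ⟨j, hj, rfl⟩ := hv
      refine hasMulTable.other i j fun h => ?_
      cases h <;> first | exact hi _ rfl | exact hj _ rfl
    | zero => exact mul_zero _
    | add _ _ _ _ h h' => rw [mul_add, h, h', add_zero]
    | smul r _ _ h => rw [mul_smul_comm, h, smul_zero]
  | zero => exact zero_mul _
  | add _ _ _ _ h h' => rw [add_mul, h, h', add_zero]
  | smul r _ _ h => rw [smul_mul_assoc, h, smul_zero]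

theorem gen_mul_assocProd (x y z : X) (t : Sym2 X) :
    basis F X (gen x) * basis F X (assocProd y z t) = 0 := basis_mul _ _

theorem gen_mul_tch (x y : X) (t : Sym X 3) :
    basis F X (gen x) * basis F X (tch y t) = 0 := basis_mul _ _

theorem gen_mul_word (x y : X) (t : Multiset X) (ht : 4 ≤ t.card) :
    basis F X (gen x) * basis F X (word y t ht) = 0 := basis_mul _ _

theorem assocProd_mul_gen (x y z : X) (t : Sym2 X) :
    basis F X (assocProd y z t) * basis F X (gen x) = 0 := basis_mul _ _

theorem tch_mul_gen (x y : X) (t : Sym X 3) :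
    basis F X (tch x t) * basis F X (gen y) = basis F X (word x (y ::ₘ t.1) (by simp)) :=
  basis_mul _ _

variable (x y z : X) {v : Model F X} (hv : v ∈ decomposables F X)
include hv

/-- Left multiplication by a generator moves `prod` to `left`, then `left` and `assoc` to
`assocProd`, and kills all other types of decomposable base elements. -/
theorem gen_gen_gen_mul :
    basis F X (gen x) * (basis F X (gen y) * (basis F X (gen z) * v)) = 0 := by
  induction hv using decomposables_induction
  case zero => simp only [mul_zero]
  case add _ _ _ _ ha hb => simp only [mul_add, ha, hb, add_zero]
  case smul _ _ _ ha => simp only [mul_smul_comm, ha, smul_zero]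
  all_goals
    simp only [hasMulTable.gen_prod, hasMulTable.gen_left, hasMulTable.gen_assoc, mul_neg, mul_zero,
      gen_mul_assocProd, gen_mul_tch, gen_mul_word, neg_zero]

theorem gen_gen_mul_mul :
    basis F X (gen x) * (basis F X (gen y) * (v * basis F X (gen z))) = 0 := by
  induction hv using decomposables_induction
  case zero => simp only [mul_zero, zero_mul]
  case add _ _ _ _ ha hb => simp only [mul_add, add_mul, ha, hb, add_zero]
  case smul _ _ _ ha => simp only [mul_smul_comm, smul_mul_assoc, ha, smul_zero]
  all_goals
    simp only [hasMulTable.gen_left, hasMulTable.gen_assoc, mul_neg, mul_zero,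
      gen_mul_assocProd, gen_mul_tch, gen_mul_word, neg_zero, hasMulTable.prod_gen,
      hasMulTable.left_gen, hasMulTable.assoc_gen, tch_mul_gen, hasMulTable.word_gen,
      assocProd_mul_gen, mul_add, mul_sub, add_zero, sub_zero]

/-- Two right multiplications bring a decomposable element into the span of the types `assocProd`,
`tch` and `word`, all killed by left multiplication. -/
theorem gen_mul_mul_mul :
    basis F X (gen x) * (v * basis F X (gen y) * basis F X (gen z)) = 0 := by
  induction hv using decomposables_induction
  case zero => simp only [mul_zero, zero_mul]
  case add _ _ _ _ ha hb => simp only [mul_add, add_mul, ha, hb, add_zero]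
  case smul _ _ _ ha => simp only [mul_smul_comm, smul_mul_assoc, ha, smul_zero]
  all_goals
    simp only [mul_zero,
      gen_mul_assocProd, gen_mul_tch, gen_mul_word, hasMulTable.prod_gen,
      hasMulTable.left_gen, hasMulTable.assoc_gen, tch_mul_gen, hasMulTable.word_gen,
      assocProd_mul_gen, mul_add, add_mul, sub_mul, zero_mul, mul_sub, add_zero, sub_zero]

theorem mul_gen_mul_gen_comm :
    v * basis F X (gen x) * basis F X (gen y) = v * basis F X (gen y) * basis F X (gen x) := by
  induction hv using decomposables_induction
  case zero => simp only [zero_mul]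
  case add _ _ _ _ ha hb => simp only [add_mul, ha, hb]
  case smul _ _ _ ha => simp only [smul_mul_assoc, ha]
  case prod s t =>
    simp only [hasMulTable.prod_gen, add_mul, hasMulTable.left_gen, hasMulTable.assoc_gen]
    rw [Sym.cons_swap x y, Sym2.eq_swap (a := x) (b := y)]
    abel
  case left =>
    simp only [hasMulTable.left_gen, add_mul, sub_mul, assocProd_mul_gen]
  case assoc s t u =>
    simp only [hasMulTable.assoc_gen, add_mul, assocProd_mul_gen, tch_mul_gen]
    congr 3
    rw [Sym.cons_swap u x, Sym.cons_swap t x, Sym.cons_swap u y, Sym.cons_swap t y]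
    exact Multiset.cons_swap y x (t ::ₘ u ::ₘ 0)
  case assocProd => simp only [assocProd_mul_gen, zero_mul]
  case tch s t u w =>
    simp only [tch_mul_gen, hasMulTable.word_gen]
    congr 2
    exact Multiset.cons_swap _ _ _
  case word s t ht =>
    simp only [hasMulTable.word_gen]
    congr 2
    exact Multiset.cons_swap _ _ _

/-- This is right symmetry $(x,v,y)=(x,y,v)$ for decomposable $v$, where $(xy)v=0$. -/
theorem associator_gen_mul_gen :
    basis F X (gen x) * v * basis F X (gen y) - basis F X (gen x) * (v * basis F X (gen y)) =
      -(basis F X (gen x) * (basis F X (gen y) * v)) := by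
  induction hv using decomposables_induction
  case zero => simp only [zero_mul, mul_zero, sub_zero, neg_zero]
  case add _ _ _ _ ha hb =>
    simp only [add_mul, mul_add, neg_add, ← ha, ← hb]
    abel
  case smul _ _ _ ha => simp only [smul_mul_assoc, mul_smul_comm, ← smul_sub, ha, smul_neg]
  case prod s t =>
    simp only [hasMulTable.gen_prod, hasMulTable.prod_gen, mul_add, hasMulTable.left_gen,
      hasMulTable.gen_left, hasMulTable.gen_assoc]
    rw [Sym2.eq_swap (a := t) (b := y)]
    abel
  all_goals
    simp only [hasMulTable.gen_left, hasMulTable.gen_assoc, mul_neg, mul_zero,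
      gen_mul_assocProd, gen_mul_tch, gen_mul_word, neg_zero, neg_mul, 
      hasMulTable.left_gen, hasMulTable.assoc_gen, tch_mul_gen, hasMulTable.word_gen,
      assocProd_mul_gen, mul_add, zero_mul, mul_sub, add_zero, sub_zero]

omit hv

theorem associator_comm (a b c : Model F X) : associator a b c = associator a c b := by
  have mz {u v : Model F X} (hu : u ∈ decomposables F X) (hv : v ∈ decomposables F X) :=
    mul_eq_zero_of_mem hu hv
  have m (a b : Model F X) := mul_mem a b
  simp only [associator_apply]
  induction a using induction with
  | add a a' h h' =>
    simp only [add_mul, add_sub_add_comm, h, h']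
  | smul r a h => simp only [smul_mul_assoc, ← smul_sub, h]
  | gen x =>
    induction b using induction with
    | add b b' h h' => simp only [add_mul, mul_add, add_sub_add_comm, h, h']
    | smul r b h => simp only [smul_mul_assoc, mul_smul_comm, ← smul_sub, h]
    | gen y =>
      induction c using induction with
      | add c c' h h' => simp only [add_mul, mul_add, add_sub_add_comm, h, h']
      | smul r c h => simp only [smul_mul_assoc, mul_smul_comm, ← smul_sub, h]
      | gen z =>
        simp only [hasMulTable.gen_gen, hasMulTable.gen_prod, hasMulTable.prod_gen,
          add_sub_cancel_right, Sym2.eq_swap (a := y)]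
      | dec v hv => rw [associator_gen_mul_gen x y hv, mz (m _ _) hv, zero_sub]
    | dec v hv =>
      induction c using induction with
      | add c c' h h' => simp only [add_mul, mul_add, add_sub_add_comm, h, h']
      | smul r c h => simp only [smul_mul_assoc, mul_smul_comm, ← smul_sub, h]
      | gen z => rw [associator_gen_mul_gen x z hv, mz (m _ _) hv, zero_sub]
      | dec w hw => rw [mz (m _ _) hv, mz (m _ _) hw, mz hv hw, mz hw hv]
  | dec v hv =>
    rw [mz hv (m b c), mz hv (m c b), sub_zero, sub_zero]
    induction b using induction with
    | add b b' h h' => simp only [add_mul, mul_add, h, h']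
    | smul r b h => simp only [smul_mul_assoc, mul_smul_comm, h]
    | gen y =>
      induction c using induction with
      | add c c' h h' => simp only [add_mul, mul_add, h, h']
      | smul r c h => simp only [smul_mul_assoc, mul_smul_comm, h]
      | gen z => exact mul_gen_mul_gen_comm y z hv
      | dec w hw => rw [mz (m _ _) hw, mz hv hw, zero_mul]
    | dec w hw => rw [mz (m _ _) hw, mz hv hw, zero_mul]

theorem mul_associator (a b c d : Model F X) :
    a * associator b c d = associator b c (a * d) := by
  have mz {u v : Model F X} (hu : u ∈ decomposables F X) (hv : v ∈ decomposables F X) :=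
    mul_eq_zero_of_mem hu hv
  have m (a b : Model F X) := mul_mem a b
  simp only [associator_apply]
  -- What remains is $a(b,c,d)=-b(c(ad))$. Both sides vanish as soon as one of the arguments is
  -- decomposable; for four generators both are $(b,ac,d)$.
  rw [mz (m b c) (m a d), zero_sub]
  induction a using induction with
  | add a a' h h' => simp only [add_mul, mul_add, neg_add, h, h']
  | smul r a h => simp only [smul_mul_assoc, mul_smul_comm, h, smul_neg]
  | dec v hv =>
    rw [mz hv (sub_mem (m _ _) (m _ _)), eq_comm, neg_eq_zero]
    induction b using induction with
    | add b b' h h' => simp only [add_mul, h, h', add_zero]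
    | smul r b h => simp only [smul_mul_assoc, h, smul_zero]
    | dec w hw => exact mz hw (m _ _)
    | gen y =>
      induction c using induction with
      | add c c' h h' => simp only [add_mul, mul_add, h, h', add_zero]
      | smul r c h => simp only [smul_mul_assoc, mul_smul_comm, h, smul_zero]
      | dec w hw => rw [mz hw (m _ _), mul_zero]
      | gen z =>
        induction d using induction with
        | add d d' h h' => simp only [mul_add, h, h', add_zero]
        | smul r d h => simp only [mul_smul_comm, h, smul_zero]
        | dec w hw => rw [mz hv hw, mul_zero, mul_zero]
        | gen t => exact gen_gen_mul_mul y z t hv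
  | gen x =>
    induction b using induction with
    | add b b' h h' => simp only [add_mul, mul_add, neg_add, add_sub_add_comm, h, h']
    | smul r b h => simp only [smul_mul_assoc, mul_smul_comm, ← smul_sub, h, smul_neg]
    | dec v hv =>
      rw [mz hv (m _ _), mz hv (m _ _), sub_zero, neg_zero]
      induction c using induction with
      | add c c' h h' => simp only [add_mul, mul_add, h, h', add_zero]
      | smul r c h => simp only [smul_mul_assoc, mul_smul_comm, h, smul_zero]
      | dec w hw => rw [mz hv hw, zero_mul, mul_zero]
      | gen y =>
        induction d using induction with
        | add d d' h h' => simp only [mul_add, h, h', add_zero]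
        | smul r d h => simp only [mul_smul_comm, h, smul_zero]
        | dec w hw => rw [mz (m _ _) hw, mul_zero]
        | gen t => exact gen_mul_mul_mul x y t hv
    | gen y =>
      induction c using induction with
      | add c c' h h' => simp only [add_mul, mul_add, neg_add, add_sub_add_comm, h, h']
      | smul r c h => simp only [smul_mul_assoc, mul_smul_comm, ← smul_sub, h, smul_neg]
      | dec v hv =>
        rw [mz hv (m _ _), mul_zero, neg_zero]
        induction d using induction with
        | add d d' h h' => simp only [mul_add, add_sub_add_comm, h, h', add_zero]
        | smul r d h => simp only [mul_smul_comm, ← smul_sub, h, smul_zero]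
        | dec w hw => rw [mz (m _ _) hw, mz hv hw, mul_zero, sub_zero, mul_zero]
        | gen t => rw [associator_gen_mul_gen y t hv, mul_neg, gen_gen_gen_mul x y t hv, neg_zero]
      | gen z =>
        induction d using induction with
        | add d d' h h' => simp only [mul_add, neg_add, add_sub_add_comm, h, h']
        | smul r d h => simp only [mul_smul_comm, ← smul_sub, h, smul_neg]
        | dec w hw =>
          rw [mz (m _ _) hw, zero_sub, mul_neg, gen_gen_gen_mul _ _ _ hw, gen_gen_gen_mul _ _ _ hw]
        | gen t =>
          simp only [hasMulTable.gen_gen, hasMulTable.gen_prod, hasMulTable.prod_gen,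
            add_sub_cancel_right, hasMulTable.gen_assoc, hasMulTable.gen_left, neg_neg]

omit x y z

theorem isWeaklyNovikovMetabelian : IsWeaklyNovikovMetabelian (Model F X) := by
  rintro _ (⟨a, b, c⟩ | ⟨a, b, c, d⟩ | ⟨a, b, c, d⟩)
  · exact sub_eq_zero.2 (associator_comm a b c)
  · exact sub_eq_zero.2 (mul_associator a b c d)
  · exact mul_eq_zero_of_mem (mul_mem a b) (mul_mem c d)

theorem tch_basis (x t₁ t₂ t₃ : X) :
    Tch (basis F X (gen x)) (basis F X (gen t₁)) (basis F X (gen t₂)) (basis F X (gen t₃)) =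
      basis F X (tch x (t₁ ::ₛ t₂ ::ₛ t₃ ::ₛ Sym.nil)) := by
  -- The model is already known to lie in the variety, so `Tch` can be read off from
  -- $(x,t_1,t_2)t_3$ and $(x,yz,t)=y(x,z,t)$.
  simp only [isWeaklyNovikovMetabelian.tch_eq, isWeaklyNovikovMetabelian.associator_mul_mid]
  simp only [associator_apply, hasMulTable.gen_gen, hasMulTable.gen_prod, hasMulTable.prod_gen,
    hasMulTable.gen_assoc, add_sub_cancel_right, hasMulTable.assoc_gen]

theorem isBaseFamily_basis :
    IsBaseFamily (fun x : X => basis F X (gen x)) (basis F X) where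
  gen x := rfl
  prod x y := (hasMulTable.gen_gen x y).symm
  left x y z := by rw [hasMulTable.gen_gen, hasMulTable.gen_prod]
  assoc x t₁ t₂ := by
    simp only [associator_apply, hasMulTable.gen_gen, hasMulTable.gen_prod, hasMulTable.prod_gen,
      add_sub_cancel_right]
  assocProd x y t₁ t₂ := by
    simp only [associator_apply, hasMulTable.gen_gen, hasMulTable.gen_prod, hasMulTable.prod_gen,
      mul_add, hasMulTable.left_gen, hasMulTable.gen_assoc, hasMulTable.gen_left]
    abel
  tch x t₁ t₂ t₃ := (tch_basis x t₁ t₂ t₃).symm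
  word x t ht := by
    match t, ht with
    | a :: b :: c :: d :: l, ht =>
      -- The first four letters go through `Tch`; each later letter is one right multiplication,
      -- hence induction from the right end.
      induction l using List.reverseRecOn with
      | nil =>
        change _ = basis F X (gen x) * _ * _ * _ * _
        rw [isWeaklyNovikovMetabelian.mul_mul_mul_mul, tch_basis]
        exact (hasMulTable.tch_gen x a b c d).symm
      | append_singleton l y ih =>
        have h4 : 4 ≤ (↑(a :: b :: c :: d :: l) : Multiset X).card := by simp
        have h := ih h4
        have h' (g : X → Model F X) (v : Model F X) :
            rWord v ((a :: b :: c :: d :: (l ++ [y])).map g) =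
              rWord v ((a :: b :: c :: d :: l).map g) * g y := by
          simp [rWord]
        rw [h', ← h]
        refine Eq.trans ?_ (hasMulTable.word_gen x _ h4 y).symm
        congr 2
        exact Multiset.coe_eq_coe.2 (List.perm_append_comm (l₁ := a :: b :: c :: d :: l) (l₂ := [y]))

end Model

end Model

/-! ### Quotient algebras, homomorphisms and base families -/

section Quotients

variable {F A B : Type*} [Field F] [NonUnitalNonAssocRing A] [Module F A]
  [NonUnitalNonAssocRing B] [Module F B]

theorem idealSpan_le {S : Set A} {I : Submodule F A} (hS : S ⊆ I)
    (hI : ∀ a : A, ∀ x ∈ I, a * x ∈ I ∧ x * a ∈ I) : idealSpan F S ≤ I :=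
  sInf_le ⟨hS, hI⟩

theorem subset_idealSpan (S : Set A) : S ⊆ idealSpan F S := fun _ hx =>
  Submodule.mem_sInf.2 fun _ hI => hI.1 hx

namespace Quo

theorem mk_associator (S : Set A) (a b c : A) :
    mk F S (associator a b c) = associator (mk F S a) (mk F S b) (mk F S c) := by
  simp only [associator_apply, map_sub, mk_mul]

theorem mk_eq_zero {S : Set A} {a : A} (ha : a ∈ S) : mk F S a = 0 :=
  (Submodule.Quotient.mk_eq_zero _).2 (subset_idealSpan S ha)

/-- The homomorphism of a quotient algebra induced by a homomorphism vanishing on the relations. -/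
def lift (S : Set A) (f : A →ₙₐ[F] B) (hf : ∀ s ∈ S, f s = 0) : Quo F S →ₙₐ[F] B :=
  let I : Submodule F A := LinearMap.ker (f : A →ₗ[F] B)
  have h : idealSpan F S ≤ I := idealSpan_le hf fun a x hx => by
    have hx : f x = 0 := hx
    constructor
    · change f (a * x) = 0
      rw [map_mul, hx, mul_zero]
    · change f (x * a) = 0
      rw [map_mul, hx, zero_mul]
  let g : Quo F S →ₗ[F] B := (idealSpan F S).liftQ (f : A →ₗ[F] B) h
  { g with
    map_zero' := map_zero g
    map_mul' := fun a b => by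
      obtain ⟨a, rfl⟩ := mk_surjective F a
      obtain ⟨b, rfl⟩ := mk_surjective F b
      exact map_mul f a b }

theorem isWeaklyNovikovMetabelian {S : Set A} (hS : ∀ a, WeaklyNovikovRel A a → a ∈ S) :
    IsWeaklyNovikovMetabelian (Quo F S) := by
  rintro _ (⟨a, b, c⟩ | ⟨a, b, c, d⟩ | ⟨a, b, c, d⟩) <;>
    obtain ⟨a, rfl⟩ := mk_surjective F a <;>
    obtain ⟨b, rfl⟩ := mk_surjective F b <;>
    obtain ⟨c, rfl⟩ := mk_surjective F c
  · simpa only [map_sub, mk_associator] using mk_eq_zero (hS _ (.rightSymm a b c))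
  · obtain ⟨d, rfl⟩ := mk_surjective F d
    simpa only [map_sub, mk_mul, mk_associator] using mk_eq_zero (hS _ (.weaklyNovikov a b c d))
  · obtain ⟨d, rfl⟩ := mk_surjective F d
    simpa only [mk_mul] using mk_eq_zero (hS _ (.metabelian a b c d))

end Quo

theorem map_associator (f : A →ₙₐ[F] B) (a b c : A) :
    f (associator a b c) = associator (f a) (f b) (f c) := by
  simp only [associator_apply, map_sub, map_mul]

theorem WeaklyNovikovRel.map (f : A →ₙₐ[F] B) {a : A} (h : WeaklyNovikovRel A a) :
    WeaklyNovikovRel B (f a) := by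
  obtain ⟨a, b, c⟩ | ⟨a, b, c, d⟩ | ⟨a, b, c, d⟩ := h
  · simpa only [map_sub, map_associator] using .rightSymm (f a) (f b) (f c)
  · simpa only [map_sub, map_mul, map_associator] using .weaklyNovikov (f a) (f b) (f c) (f d)
  · simpa only [map_mul] using .metabelian (f a) (f b) (f c) (f d)

theorem NovikovRel.map (f : A →ₙₐ[F] B) {a : A} (h : NovikovRel A a) : NovikovRel B (f a) := by
  obtain ⟨a, h⟩ | ⟨a, b, c⟩ := h
  · exact .weakly _ (h.map f)
  · simpa only [map_sub, map_mul] using .leftComm (f a) (f b) (f c)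

theorem IsBaseFamily.map {X : Type*} {g : X → A} {b : BaseIndex X → A} (hb : IsBaseFamily g b)
    (f : A →ₙₐ[F] B) : IsBaseFamily (fun x => f (g x)) (fun i => f (b i)) where
  gen x := by rw [hb.gen]
  prod x y := by rw [hb.prod, map_mul]
  left x y z := by rw [hb.left, map_mul, map_mul]
  assoc x t₁ t₂ := by rw [hb.assoc, map_associator]
  assocProd x y t₁ t₂ := by rw [hb.assocProd, map_associator, map_mul]
  tch x t₁ t₂ t₃ := by
    simp only [hb.tch, Tch, map_sub, map_nsmul, map_associator, map_mul]
  word x t ht := by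
    rw [hb.word x t ht]
    generalize g x = a
    clear ht
    induction t generalizing a with
    | nil => rfl
    | cons y t ih => exact (ih (a * g y)).trans (by rw [map_mul]; rfl)

theorem IsBaseFamily.unique {X : Type*} {g : X → A} {b b' : BaseIndex X → A}
    (hb : IsBaseFamily g b) (hb' : IsBaseFamily g b') : b = b' := by
  funext i
  match i with
  | .gen x => rw [hb.gen, hb'.gen]
  | .prod x y => rw [hb.prod, hb'.prod]
  | .left x y z => rw [hb.left, hb'.left]
  | .assoc x t => induction t with | _ s t => rw [hb.assoc, hb'.assoc]
  | .assocProd x y t => induction t with | _ s t => rw [hb.assocProd, hb'.assocProd]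
  | .tch x t =>
    obtain ⟨a, b, c, rfl⟩ := exists_eq_cons₃ t
    rw [hb.tch, hb'.tch]
  | .word x t ht =>
    induction t using Quot.inductionOn with
    | _ l => exact (hb.word x l ht).trans (hb'.word x l ht).symm

end Quotients

/-! ### The basis of the free algebra -/

section Free

variable {F X : Type*} [Field F]

open FreeNonUnitalNonAssocAlgebra in
theorem freeAlgebra_mem_of_mul_mem {N : Submodule F (FreeNonUnitalNonAssocAlgebra F X)}
    (hof : ∀ x, of F x ∈ N) (hmul : ∀ a ∈ N, ∀ b ∈ N, a * b ∈ N)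
    (a : FreeNonUnitalNonAssocAlgebra F X) : a ∈ N := by
  have h (m : FreeMagma X) : MonoidAlgebra.ofMagma F _ m ∈ N := by
    induction m using FreeMagma.recOnMul with
    | ih1 x => exact hof x
    | ih2 m n hm hn => rw [map_mul]; exact hmul _ hm _ hn
  induction a using MonoidAlgebra.induction_linear with
  | zero => exact zero_mem _
  | add a b ha hb => exact add_mem ha hb
  | single m r =>
    have := N.smul_mem r (h m)
    simpa using this

theorem HasMulTable.mul_mem_span {A : Type*} [NonUnitalNonAssocRing A] [Module F A]
    [IsScalarTower F A A] [SMulCommClass F A A] {b : BaseIndex X → A} (hb : HasMulTable b)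
    {u v : A} (hu : u ∈ Submodule.span F (Set.range b)) (hv : v ∈ Submodule.span F (Set.range b)) :
    u * v ∈ Submodule.span F (Set.range b) := by
  have m (i : BaseIndex X) : b i ∈ Submodule.span F (Set.range b) :=
    Submodule.subset_span ⟨i, rfl⟩
  induction hu using Submodule.span_induction with
  | mem u hu =>
    obtain ⟨i, rfl⟩ := hu
    induction hv using Submodule.span_induction with
    | mem v hv =>
      obtain ⟨j, rfl⟩ := hv
      by_cases h : Listed i j
      · cases h with
        | gen_gen x y => rw [hb.gen_gen]; exact m _
        | gen_prod x y z => rw [hb.gen_prod]; exact m _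
        | gen_left x y z t => rw [hb.gen_left]; exact neg_mem (m _)
        | gen_assoc x y t => induction t with | _ s t => rw [hb.gen_assoc]; exact m _
        | prod_gen x z y => rw [hb.prod_gen]; exact add_mem (m _) (m _)
        | left_gen x z t y => rw [hb.left_gen]; exact add_mem (sub_mem (m _) (m _)) (m _)
        | assoc_gen x t y =>
          induction t with | _ s t => rw [hb.assoc_gen]; exact add_mem (m _) (add_mem (m _) (m _))
        | tch_gen x t y =>
          obtain ⟨p, q, r, rfl⟩ := exists_eq_cons₃ t
          rw [hb.tch_gen]
          exact m _
        | word_gen x t ht y => rw [hb.word_gen]; exact m _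
      · rw [hb.other i j h]; exact zero_mem _
    | zero => rw [mul_zero]; exact zero_mem _
    | add _ _ _ _ h h' => rw [mul_add]; exact add_mem h h'
    | smul r _ _ h => rw [mul_smul_comm]; exact Submodule.smul_mem _ _ h
  | zero => rw [zero_mul]; exact zero_mem _
  | add _ _ _ _ h h' => rw [add_mul]; exact add_mem h h'
  | smul r _ _ h => rw [smul_mul_assoc]; exact Submodule.smul_mem _ _ h

theorem FreeWN.isWeaklyNovikovMetabelian : IsWeaklyNovikovMetabelian (FreeWN F X) :=
  Quo.isWeaklyNovikovMetabelian fun _ h => h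

theorem FreeNov.isWeaklyNovikovMetabelian : IsWeaklyNovikovMetabelian (FreeNov F X) :=
  Quo.isWeaklyNovikovMetabelian fun _ h => .weakly _ h

/-- The homomorphism of the free algebra extending a map of the generators. -/
noncomputable def FreeWN.lift {A : Type*} [NonUnitalNonAssocRing A] [Module F A]
    [IsScalarTower F A A] [SMulCommClass F A A] (hA : IsWeaklyNovikovMetabelian A) (g : X → A) :
    FreeWN F X →ₙₐ[F] A :=
  Quo.lift _ (FreeNonUnitalNonAssocAlgebra.lift F g) fun _ hs => hA _ (.map _ hs)

theorem FreeWN.lift_of {A : Type*} [NonUnitalNonAssocRing A] [Module F A]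
    [IsScalarTower F A A] [SMulCommClass F A A] (hA : IsWeaklyNovikovMetabelian A) (g : X → A)
    (x : X) : FreeWN.lift hA g (FreeWN.of F x) = g x :=
  FreeNonUnitalNonAssocAlgebra.lift_of_apply F g x

theorem FreeWN.mem_of_mul_mem {N : Submodule F (FreeWN F X)} (hof : ∀ x, FreeWN.of F x ∈ N)
    (hmul : ∀ a ∈ N, ∀ b ∈ N, a * b ∈ N) (a : FreeWN F X) : a ∈ N := by
  obtain ⟨a, rfl⟩ := Quo.mk_surjective F a
  exact freeAlgebra_mem_of_mul_mem (N := N.comap (Quo.mk F _)) hof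
    (fun a ha b hb => hmul _ ha _ hb) a

theorem FreeWN.exists_basis : ∃ b : Module.Basis (BaseIndex X) F (FreeWN F X),
    IsBaseFamily (FreeWN.of F) b ∧ HasMulTable b := by
  have hA := FreeWN.isWeaklyNovikovMetabelian (F := F) (X := X)
  have hb := isBaseFamily_baseFamily hA (FreeWN.of F)
  have hmul := hb.hasMulTable hA
  have hli : LinearIndependent F (baseFamily hA (FreeWN.of F)) := by
    let φ := FreeWN.lift (F := F) Model.isWeaklyNovikovMetabelian
      fun x : X => Model.basis F X (.gen x)
    -- A base family is determined by its generators, so the image of the base family under `φ` is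
    -- the basis of the model.
    have h := (hb.map φ).unique
      (by simpa only [φ, FreeWN.lift_of] using Model.isBaseFamily_basis)
    refine LinearIndependent.of_comp (φ : FreeWN F X →ₗ[F] Model F X) ?_
    have h' : (φ : FreeWN F X →ₗ[F] Model F X) ∘ baseFamily hA (FreeWN.of F) = Model.basis F X := h
    rw [h']
    exact (Model.basis F X).linearIndependent
  have hspan : ⊤ ≤ Submodule.span F (Set.range (baseFamily hA (FreeWN.of F))) := fun a _ =>
    FreeWN.mem_of_mul_mem
      (fun x => hb.gen x ▸ Submodule.subset_span (Set.mem_range_self _))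
      (fun _ hu _ hv => hmul.mul_mem_span hu hv) a
  refine ⟨.mk hli hspan, ?_⟩
  rw [Module.Basis.coe_mk]
  exact ⟨hb, hmul⟩

end Free

/-! ### Left nilpotency of exact index five -/

section Nilpotency

variable (F : Type*) [Field F]

section

variable {F} {A : Type*} [NonUnitalNonAssocRing A] [Module F A]

theorem leftPow_succ_eq_bot {n : ℕ} (h : leftPow F A (n + 1) = ⊥) : leftPow F A (n + 2) = ⊥ := by
  rw [leftPow, Submodule.span_eq_bot]
  rintro _ ⟨a, b, hb, rfl⟩
  rw [h, Submodule.mem_bot] at hb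
  rw [hb, mul_zero]

theorem mul_mem_leftPow {n : ℕ} (a : A) {b : A} (hb : b ∈ leftPow F A (n + 1)) :
    a * b ∈ leftPow F A (n + 2) := Submodule.subset_span ⟨a, b, hb, rfl⟩

theorem leftPow_ne_bot {a b c d : A} (h : a * (b * (c * d)) ≠ 0) :
    ∀ m < 5, leftPow F A m ≠ ⊥ := by
  have h4 : leftPow F A 4 ≠ ⊥ := fun h' => h <| by
    have hd : d ∈ leftPow F A 1 := Submodule.mem_top
    rw [← Submodule.mem_bot F, ← h']
    exact mul_mem_leftPow _ (mul_mem_leftPow _ (mul_mem_leftPow _ hd))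
  have h3 : leftPow F A 3 ≠ ⊥ := fun h => h4 (leftPow_succ_eq_bot h)
  have h2 : leftPow F A 2 ≠ ⊥ := fun h => h3 (leftPow_succ_eq_bot h)
  have h1 : leftPow F A 1 ≠ ⊥ := fun h => h2 (leftPow_succ_eq_bot h)
  intro m hm
  match m, hm with
  -- The zeroth left power is the whole algebra by convention, just as the first.
  | 0, _ => exact h1
  | 1, _ => exact h1
  | 2, _ => exact h2
  | 3, _ => exact h3
  | 4, _ => exact h4

theorem forall_leftPow {n : ℕ} {p : A → Prop} (zero : p 0) (add : ∀ a b, p a → p b → p (a + b))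
    (smul : ∀ (r : F) a, p a → p (r • a)) (mul : ∀ a, ∀ b ∈ leftPow F A (n + 1), p (a * b)) :
    ∀ c ∈ leftPow F A (n + 2), p c := fun c hc => by
  induction hc using Submodule.span_induction with
  | mem c hc =>
    obtain ⟨a, b, hb, rfl⟩ := hc
    exact mul a b hb
  | zero => exact zero
  | add a b _ _ ha hb => exact add a b ha hb
  | smul r a _ ha => exact smul r a ha

theorem IsWeaklyNovikovMetabelian.leftPow_five [SMulCommClass F A A]
    (hA : IsWeaklyNovikovMetabelian A) :
    leftPow F A 5 = ⊥ := by
  have h2 : ∀ v ∈ leftPow F A 2, ∀ a b c : A, a * (b * (c * v)) = 0 :=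
    forall_leftPow (by simp) (fun u v hu hv a b c => by simp only [mul_add, hu, hv, add_zero])
      (fun r u hu a b c => by simp only [mul_smul_comm, hu, smul_zero])
      -- Here $b(c(de))=-(b,dc,e)$, and left multiplication kills an associator with a product in
      -- the middle.
      (fun d e _ a b c => by rw [hA.mul_mul_mul_right b, mul_neg, hA.mul_associator_mul, neg_zero])
  have h3 : ∀ v ∈ leftPow F A 3, ∀ a b : A, a * (b * v) = 0 :=
    forall_leftPow (by simp) (fun u v hu hv a b => by simp only [mul_add, hu, hv, add_zero])
      (fun r u hu a b => by simp only [mul_smul_comm, hu, smul_zero])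
      (fun c v hv a b => h2 v hv a b c)
  have h4 : ∀ v ∈ leftPow F A 4, ∀ a : A, a * v = 0 :=
    forall_leftPow (by simp) (fun u v hu hv a => by simp only [mul_add, hu, hv, add_zero])
      (fun r u hu a => by simp only [mul_smul_comm, hu, smul_zero])
      (fun b v hv a => h3 v hv a b)
  rw [leftPow, Submodule.span_eq_bot]
  rintro _ ⟨a, v, hv, rfl⟩
  exact h4 v hv a

end

/-- A five-dimensional Novikov metabelian algebra, which is left nilpotent of exact index five. -/
def FiveDim : Type _ := Fin 5 → F

namespace FiveDim

instance : AddCommGroup (FiveDim F) := inferInstanceAs (AddCommGroup (Fin 5 → F))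

instance : Module F (FiveDim F) := inferInstanceAs (Module F (Fin 5 → F))

/-- The coordinates refer to $e$, $e^2$, $e\cdot e^2$, $(e,e,e)$, $(e,e^2,e)$. The coefficients come
from the multiplication table for one generator, with the `tch` and `word` elements set to zero. -/
instance : Mul (FiveDim F) :=
  ⟨fun a b => ![0, a 0 * b 0, a 0 * b 1 + a 1 * b 0, a 1 * b 0,
    a 2 * b 0 + 2 * (a 3 * b 0) - a 0 * b 2 + a 0 * b 3]⟩

variable {F}

theorem add_apply (a b : FiveDim F) (i : Fin 5) : (a + b) i = a i + b i := rfl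

theorem sub_apply (a b : FiveDim F) (i : Fin 5) : (a - b) i = a i - b i := rfl

theorem zero_apply (i : Fin 5) : (0 : FiveDim F) i = 0 := rfl

theorem smul_apply (r : F) (a : FiveDim F) (i : Fin 5) : (r • a) i = r * a i := rfl

theorem mul_apply_zero (a b : FiveDim F) : (a * b) 0 = 0 := rfl

theorem mul_apply_one (a b : FiveDim F) : (a * b) 1 = a 0 * b 0 := rfl

theorem mul_apply_two (a b : FiveDim F) : (a * b) 2 = a 0 * b 1 + a 1 * b 0 := rfl

theorem mul_apply_three (a b : FiveDim F) : (a * b) 3 = a 1 * b 0 := rfl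

theorem mul_apply_four (a b : FiveDim F) :
    (a * b) 4 = a 2 * b 0 + 2 * (a 3 * b 0) - a 0 * b 2 + a 0 * b 3 := rfl

omit [Field F] in
theorem ext_five {a b : FiveDim F} (h0 : a 0 = b 0) (h1 : a 1 = b 1) (h2 : a 2 = b 2)
    (h3 : a 3 = b 3) (h4 : a 4 = b 4) : a = b :=
  funext fun i => by fin_cases i <;> assumption

instance : NonUnitalNonAssocRing (FiveDim F) :=
  { (inferInstance : AddCommGroup (FiveDim F)), (inferInstance : Mul (FiveDim F)) with
    left_distrib a b c := by
      apply ext_five <;> simp only [mul_apply_zero, mul_apply_one, mul_apply_two, mul_apply_three,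
        mul_apply_four, add_apply] <;> ring
    right_distrib a b c := by
      apply ext_five <;> simp only [mul_apply_zero, mul_apply_one, mul_apply_two, mul_apply_three,
        mul_apply_four, add_apply] <;> ring
    zero_mul a := by
      apply ext_five <;> simp only [mul_apply_zero, mul_apply_one, mul_apply_two, mul_apply_three,
        mul_apply_four, zero_apply] <;> ring
    mul_zero a := by
      apply ext_five <;> simp only [mul_apply_zero, mul_apply_one, mul_apply_two, mul_apply_three,
        mul_apply_four, zero_apply] <;> ring }

instance : IsScalarTower F (FiveDim F) (FiveDim F) where
  smul_assoc r a b := by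
    apply ext_five <;> simp only [smul_eq_mul, mul_apply_zero, mul_apply_one, mul_apply_two,
      mul_apply_three, mul_apply_four, smul_apply] <;> ring

instance : SMulCommClass F (FiveDim F) (FiveDim F) where
  smul_comm r a b := by
    apply ext_five <;> simp only [smul_eq_mul, mul_apply_zero, mul_apply_one, mul_apply_two,
      mul_apply_three, mul_apply_four, smul_apply] <;> ring

theorem isWeaklyNovikovMetabelian : IsWeaklyNovikovMetabelian (FiveDim F) := by
  rintro _ (⟨a, b, c⟩ | ⟨a, b, c, d⟩ | ⟨a, b, c, d⟩) <;> apply ext_five <;>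
    simp only [associator_apply, mul_apply_zero, mul_apply_one, mul_apply_two, mul_apply_three,
      mul_apply_four, sub_apply, zero_apply] <;> ring

theorem eq_zero_of_novikovRel {a : FiveDim F} (h : NovikovRel (FiveDim F) a) : a = 0 := by
  obtain ⟨_, h⟩ | ⟨a, b, c⟩ := h
  · exact isWeaklyNovikovMetabelian _ h
  -- The only possibly nonzero coordinates of $a(bc)$ are $a_0b_0c_0$ and $-a_0b_0c_1$, both
  -- symmetric in $a,b$.
  · apply ext_five <;> simp only [mul_apply_zero, mul_apply_one, mul_apply_two, mul_apply_three,
      mul_apply_four, sub_apply, zero_apply] <;> ring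

variable (F) in
/-- The generator of the algebra. -/
def e : FiveDim F := ![1, 0, 0, 0, 0]

theorem e_mul_e_mul_e_mul_e : e F * (e F * (e F * e F)) ≠ 0 := fun h => by
  have h0 : e F 0 = 1 := rfl
  have h1 : e F 1 = 0 := rfl
  have h2 : e F 2 = 0 := rfl
  -- The last coordinate of $e(e(ee))=-(e,e^2,e)$ is $-1$.
  have h4 : (e F * (e F * (e F * e F))) 4 = 0 := congrFun h 4
  simp [mul_apply_zero, mul_apply_one, mul_apply_two, mul_apply_three, mul_apply_four, h0, h1,
    h2] at h4

end FiveDim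

theorem isLeftNilpotentOfIndex_five {A : Type*} [NonUnitalNonAssocRing A] [Module F A]
    [SMulCommClass F A A] (hA : IsWeaklyNovikovMetabelian A) (f : A →ₙₐ[F] FiveDim F) (x : A)
    (hx : f x = FiveDim.e F) : IsLeftNilpotentOfIndex F A 5 := by
  refine ⟨hA.leftPow_five, leftPow_ne_bot (a := x) (b := x) (c := x) (d := x) fun h => ?_⟩
  have h' := congrArg f h
  simp only [map_mul, hx, map_zero] at h'
  exact FiveDim.e_mul_e_mul_e_mul_e h'

end Nilpotency

end WNM

theorem theorem2 {F : Type*} [Field F] (hF : ringChar F ≠ 2)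
    {X : Type*} [Countable X] [Infinite X] :
    (∃ b : Module.Basis (WNM.BaseIndex X) F (WNM.FreeWN F X),
      WNM.IsBaseFamily (WNM.FreeWN.of F) b ∧ WNM.HasMulTable b) ∧
    (∀ (A : Type*) [NonUnitalNonAssocRing A] [Module F A] [IsScalarTower F A A]
      [SMulCommClass F A A], WNM.IsWeaklyNovikovMetabelian A → WNM.leftPow F A 5 = ⊥) ∧
    WNM.IsLeftNilpotentOfIndex F (WNM.FreeWN F X) 5 ∧
    WNM.IsLeftNilpotentOfIndex F (WNM.FreeNov F X) 5 := by
  obtain ⟨x⟩ := (inferInstance : Nonempty X)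
  refine ⟨WNM.FreeWN.exists_basis, fun A _ _ _ _ hA => hA.leftPow_five, ?_, ?_⟩
  · exact WNM.isLeftNilpotentOfIndex_five F WNM.FreeWN.isWeaklyNovikovMetabelian
      (WNM.FreeWN.lift WNM.FiveDim.isWeaklyNovikovMetabelian fun _ => WNM.FiveDim.e F)
      (WNM.FreeWN.of F x) (WNM.FreeWN.lift_of _ _ _)
  · exact WNM.isLeftNilpotentOfIndex_five F WNM.FreeNov.isWeaklyNovikovMetabelian
      (WNM.Quo.lift _ (FreeNonUnitalNonAssocAlgebra.lift F fun _ => WNM.FiveDim.e F)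
        fun _ hs => WNM.FiveDim.eq_zero_of_novikovRel (.map _ hs))
      (WNM.Quo.mk F _ (FreeNonUnitalNonAssocAlgebra.of F x))
      (FreeNonUnitalNonAssocAlgebra.lift_of_apply F _ x)
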